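/- For $\omega=(\omega(1),\omega(2),\dots)\in\{\mathbf 0,\mathbf 1,\mathbf 2\}^{\mathbb N_+}$ let $G_\omega$ be the Grigorchuk group, i.e. the group of automorphisms of the infinite binary rooted tree $\{0,1\}^*$ (in which each finite string $v$ is joined to $v0$ and $v1$) generated by $a,b_\omega,c_\omega,d_\omega$, where $$a(xv)=(1-x)v,\qquad b_\omega(0xv)=0\,\varepsilon_{\mathbf 2\omega(1)}(x)\,v,\quad b_\omega(1v)=1\,b_{\sigma\omega}(v),$$ $$c_\omega(0xv)=0\,\varepsilon_{\mathbf 1\omega(1)}(x)\,v,\quad c_\omega(1v)=1\,c_{\sigma\omega}(v),\qquad d_\omega(0xv)=0\,\varepsilon_{\mathbf 0\omega(1)}(x)\,v,\quad d_\omega(1v)=1\,d_{\sigma\omega}(v)$$ for $x\in\{0,1\}$ and $v\in\{0,1\}^*$, these maps fix the strings to which no rule applies (the empty string and, for $b_\omega,c_\omega,d_\omega$, the string $0$), $\sigma$ is the shift $(\sigma\omega)(n)=\omega(n+1)$, and $\varepsilon_{ij}$ is the identity of $\{0,1\}$ if $i=j$ and the non-trivial permutation of $\{0,1\}$ if $i\ne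 j$. For a homeomorphism $\psi$ of a topological space $Y$, let $[[\psi]]$ be its topological full group, i.e. the group of all homeomorphisms $g$ of $Y$ for which there is a continuous function $n:Y\to\mathbb Z$ with $g(y)=\psi^{n(y)}(y)$ for every $y\in Y$. Then for every $\omega\in\{\mathbf 0,\mathbf 1,\mathbf 2\}^{\mathbb N_+}$ there exist a finite alphabet $A$ and an infinite minimal subshift $(Y,\psi)$ over $A$ (a closed, shift-invariant infinite subset $Y\subset A^{\mathbb Z}$ with the shift map $\psi$, in which every orbit $\{\psi^n(y):n\in\mathbb Z\}$ is dense), together with an injective group homomorphism from $G_\omega$ into the commutator subgroup $[[\psi]]'$ of $[[\psi]]$. -/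

import Mathlib

/-! ### Grigorchuk groups -/

namespace Grigorchuk

/-- The infinite binary rooted tree: vertices are the finite binary strings (`false` is the digit
`0`, `true` is the digit `1`), and `v` is joined to `vx` for every digit `x`. -/
def binaryTree : SimpleGraph (List Bool) where
  Adj v w := (∃ x : Bool, w = v ++ [x]) ∨ (∃ x : Bool, v = w ++ [x])
  symm := ⟨fun _ _ h => h.symm⟩
  loopless := ⟨fun v h => by
    rcases h with ⟨x, h⟩ | ⟨x, h⟩ <;>
    · have := congrArg List.length h
      simp at this⟩

/-- The automorphism of the tree given by an involution `f` of the vertices that sends each child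
`vx` of a vertex `v` to a child of `f v`. -/
def autOfInvolutive (f : List Bool → List Bool) (hf : Function.Involutive f)
    (h : ∀ (v : List Bool) (x : Bool), ∃ y : Bool, f (v ++ [x]) = f v ++ [y]) :
    binaryTree ≃g binaryTree where
  toEquiv := hf.toPerm
  map_rel_iff' := by
    have key : ∀ v w : List Bool, binaryTree.Adj v w → binaryTree.Adj (f v) (f w) := by
      rintro v w (⟨x, rfl⟩ | ⟨x, rfl⟩)
      · exact Or.inl (h v x)
      · exact Or.inr (h w x)
    intro v w
    refine ⟨fun hvw => ?_, fun hvw => key v w hvw⟩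
    have := key _ _ hvw
    simpa [hf v, hf w] using this

/-- `a (xv) = ε(x) v`, where `ε` exchanges the two digits. -/
def aFun : List Bool → List Bool
  | [] => []
  | x :: v => (!x) :: v

/-- The common recursion behind `b_ω`, `c_ω`, `d_ω`, with a symbol `i`:
`f_ω (0xv) = 0 ε_{i ω(1)}(x) v` and `f_ω (1v) = 1 f_{σω}(v)`, where `ε_{ij}` is the identity if
`i = j` and exchanges the two digits if `i ≠ j`, and `σ` is the shift of sequences.
The sequence `ω(1), ω(2), …` is indexed by `ℕ` here, so that `ω(1)` is `ω 0`. -/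
def genFun (i : Fin 3) : (ℕ → Fin 3) → List Bool → List Bool
  | _, [] => []
  | _, [false] => [false]
  | ω, false :: x :: v => false :: (if i = ω 0 then x else !x) :: v
  | ω, true :: v => true :: genFun i (fun n => ω (n + 1)) v

theorem aFun_involutive : Function.Involutive aFun := by
  rintro (_ | ⟨x, v⟩) <;> simp [aFun]

theorem aFun_child (v : List Bool) (x : Bool) : ∃ y : Bool, aFun (v ++ [x]) = aFun v ++ [y] := by
  cases v <;> simp [aFun]

theorem genFun_involutive (i : Fin 3) (ω : ℕ → Fin 3) : Function.Involutive (genFun i ω) := by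
  intro v
  induction v generalizing ω with
  | nil => simp [genFun]
  | cons x v ih =>
    cases x with
    | true => simp [genFun, ih]
    | false =>
      cases v with
      | nil => simp [genFun]
      | cons y v => by_cases h : i = ω 0 <;> simp [genFun, h]

theorem genFun_child (i : Fin 3) (ω : ℕ → Fin 3) (v : List Bool) (x : Bool) :
    ∃ y : Bool, genFun i ω (v ++ [x]) = genFun i ω v ++ [y] := by
  induction v generalizing ω with
  | nil => cases x <;> simp [genFun]
  | cons z v ih =>
    cases z with
    | true =>
      obtain ⟨y, hy⟩ := ih (fun n => ω (n + 1))
      exact ⟨y, by simp [genFun, hy]⟩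
    | false => cases v <;> simp [genFun]

/-- The generator `a`. -/
def a : binaryTree ≃g binaryTree := autOfInvolutive aFun aFun_involutive aFun_child

/-- The automorphism of the tree with underlying map `genFun i ω`. -/
def gen (i : Fin 3) (ω : ℕ → Fin 3) : binaryTree ≃g binaryTree :=
  autOfInvolutive (genFun i ω) (genFun_involutive i ω) (genFun_child i ω)

/-- The generator `b_ω`. -/
def b (ω : ℕ → Fin 3) : binaryTree ≃g binaryTree := gen 2 ω

/-- The generator `c_ω`. -/
def c (ω : ℕ → Fin 3) : binaryTree ≃g binaryTree := gen 1 ω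

/-- The generator `d_ω`. -/
def d (ω : ℕ → Fin 3) : binaryTree ≃g binaryTree := gen 0 ω

/-- The Grigorchuk group `G_ω`, a subgroup of the automorphism group of the binary rooted tree. -/
def grigorchukGroup (ω : ℕ → Fin 3) : Subgroup (binaryTree ≃g binaryTree) :=
  Subgroup.closure {a, b ω, c ω, d ω}

end Grigorchuk

/-! ### Topological full groups and minimality -/

/-- The topological full group `[[φ]]`: all homeomorphisms `g` for which there is a continuous
function `n : X → ℤ` with `g x = φ ^ n(x) (x)` for every `x`. -/
def topologicalFullGroup {X : Type*} [TopologicalSpace X] (φ : X ≃ₜ X) : Subgroup (X ≃ₜ X) where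
  carrier := {g | ∃ n : X → ℤ, Continuous n ∧ ∀ x, g x = (φ ^ n x) x}
  one_mem' := ⟨fun _ => 0, continuous_const, fun x => by simp⟩
  mul_mem' := by
    rintro g h ⟨n, hn, hg⟩ ⟨m, hm, hh⟩
    refine ⟨fun x => n (h x) + m x, (hn.comp h.continuous).add hm, fun x => ?_⟩
    change g (h x) = _
    rw [hg (h x), zpow_add]
    change _ = (φ ^ n (h x)) ((φ ^ m x) x)
    rw [← hh x]
  inv_mem' := by
    rintro g ⟨n, hn, hg⟩
    refine ⟨fun x => -n (g.symm x), (hn.comp g.symm.continuous).neg, fun x => ?_⟩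
    change g.symm x = _
    have h := hg (g.symm x)
    rw [g.apply_symm_apply] at h
    rw [zpow_neg]
    change _ = (φ ^ n (g.symm x)).symm x
    rw [Homeomorph.eq_symm_apply]
    exact h.symm

/-- A homeomorphism is minimal if every orbit (under all its integer powers) is dense. -/
def IsMinimalHomeomorph {X : Type*} [TopologicalSpace X] (φ : X ≃ₜ X) : Prop :=
  ∀ x : X, Dense (Set.range fun n : ℤ => (φ ^ n) x)

/-! ### Subshifts -/

/-- The shift homeomorphism `(ψ y)(k) = y(k + 1)` of a two-sided subshift. -/
def subshiftHomeomorph {A : Type*} [TopologicalSpace A]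
    (Y : SymbolicDynamics.FullShift.Subshift A ℤ) : Y.carrier ≃ₜ Y.carrier where
  toFun y := ⟨SymbolicDynamics.FullShift.shift 1 y.1, Y.mapsTo 1 y.2⟩
  invFun y := ⟨SymbolicDynamics.FullShift.shift (-1) y.1, Y.mapsTo (-1) y.2⟩
  left_inv y := by ext k; simp
  right_inv y := by ext k; simp
  continuous_toFun :=
    ((SymbolicDynamics.FullShift.continuous_shift 1).comp continuous_subtype_val).subtype_mk _
  continuous_invFun :=
    ((SymbolicDynamics.FullShift.continuous_shift (-1)).comp continuous_subtype_val).subtype_mk _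

open Function Set SymbolicDynamics.FullShift

/-! ### A labelled line -/

namespace LabelledLine

/-! The complemented binary Gray code sends each integer to an infinite binary string. The codes of
`j - 1` and `j` differ in one digit, whose place is the 2-adic valuation of `j`, so the generators
of the group act on codes by moving along edges of the line `ℤ`, and the label of an edge says which
generators cross it. The codes of `j` and `-1 - j` agree: the line is two copies of a half-line,
joined by the edge `0`, where the label `t` can be chosen freely.

Choosing `t` to recur in `ω` makes the sequence of labels uniformly recurrent
(`sequence_recurrence`), so its orbit closure is minimal; the valuation parities make it aperiodic.
Each generator is a local rule on labels, hence an element of the topological full group. With two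
interleaved copies of the line it becomes a commutator (`exists_commutator_genPerm`).

It remains to see that a word is trivial on the tree iff it is trivial on the subshift. Every finite
string begins a code, which gives one direction. Conversely, a word trivial on the tree preserves
codes, which separate nonnegative integers; having bounded displacement, it fixes all large
positions. By recurrence these are dense in the subshift, so the word acts trivially there. -/

/-- The 2-adic type attached to the valuation `k`: `none` for `0`, and `ω k` for `k + 1`. -/
def valType (ω : ℕ → Fin 3) : ℕ → Option (Fin 3)
  | 0 => none
  | k + 1 => some (ω k)

/-- The label of the edge of the line `ℤ` that joins `j - 1` and `j`. -/
noncomputable def edgeType (ω : ℕ → Fin 3) (t : Fin 3) (j : ℤ) : Option (Fin 3) :=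
  if j = 0 then some t else valType ω (padicValInt 2 j)

/-- The parity of the 2-adic valuation, with a prescribed value at `0`. -/
noncomputable def edgeParity (q : Bool) (j : ℤ) : Bool :=
  if j = 0 then q else decide (Odd (padicValInt 2 j))

/-- The generator with index `s` moves the endpoints of the edges whose label is `l`. -/
def Moves (s l : Option (Fin 3)) : Prop :=
  match s with
  | none => l = none
  | some i => l ≠ none ∧ l ≠ some i

instance (s l : Option (Fin 3)) : Decidable (Moves s l) := by
  cases s <;> unfold Moves <;> infer_instance

theorem padicValInt_two_eq {j : ℤ} {k : ℕ} (h1 : (2 : ℤ) ^ k ∣ j) (h2 : ¬ (2 : ℤ) ^ (k + 1) ∣ j) :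
    padicValInt 2 j = k := by
  have e1 := (padicValInt_dvd_iff (p := 2) k j).1 (by exact_mod_cast h1)
  have e2 := mt (padicValInt_dvd_iff (p := 2) (k + 1) j).2 (by exact_mod_cast h2)
  push Not at e2
  rcases e1 with rfl | e1
  · simp at h2
  · omega

theorem padicValInt_two_odd {j : ℤ} (h : Odd j) : padicValInt 2 j = 0 :=
  padicValInt_two_eq (by simp) (by
    rw [zero_add, pow_one]; exact fun h' => (Int.not_even_iff_odd.2 h) (even_iff_two_dvd.2 h'))

theorem padicValInt_two_two_mul {j : ℤ} (h : j ≠ 0) :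
    padicValInt 2 (2 * j) = padicValInt 2 j + 1 := by
  have := padicValInt_mul_eq_succ (p := 2) j h
  rwa [mul_comm] at this

theorem edgeType_odd (ω : ℕ → Fin 3) (t : Fin 3) {j : ℤ} (h : Odd j) : edgeType ω t j = none := by
  have h0 : j ≠ 0 := by rintro rfl; simp at h
  simp [edgeType, h0, padicValInt_two_odd h, valType]

theorem edgeType_two_mul_odd (ω : ℕ → Fin 3) (t : Fin 3) {j : ℤ} (h : Odd j) :
    edgeType ω t (2 * j) = some (ω 0) := by
  have h0 : j ≠ 0 := by rintro rfl; simp at h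
  simp [edgeType, h0, padicValInt_two_two_mul h0, padicValInt_two_odd h, valType]

theorem edgeType_two_mul_even (ω : ℕ → Fin 3) (t : Fin 3) {j : ℤ} (h : Even j) :
    edgeType ω t (2 * j) = edgeType (fun n => ω (n + 1)) t j := by
  by_cases h0 : j = 0
  · simp [edgeType, h0]
  · obtain ⟨i, rfl⟩ := even_iff_two_dvd.1 h
    have hi : i ≠ 0 := by rintro rfl; simp at h0
    simp [edgeType, hi, padicValInt_two_two_mul h0, padicValInt_two_two_mul hi, valType]

theorem edgeType_eq_none_iff (ω : ℕ → Fin 3) (t : Fin 3) (j : ℤ) :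
    edgeType ω t j = none ↔ Odd j := by
  refine ⟨fun h => ?_, edgeType_odd ω t⟩
  by_contra h'
  rw [Int.not_odd_iff_even] at h'
  obtain ⟨i, rfl⟩ := even_iff_two_dvd.1 h'
  by_cases h0 : i = 0
  · simp [edgeType, h0] at h
  · simp [edgeType, h0, padicValInt_two_two_mul h0, valType] at h

/-- Consecutive edges have opposite parity, and `a` uses only odd edges, the other generators only
even ones. So each generator crosses a matching, hence acts on the line as an involution. -/
theorem not_moves_adjacent (ω : ℕ → Fin 3) (t : Fin 3) (s : Option (Fin 3)) (j : ℤ)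
    (h : Moves s (edgeType ω t j)) : ¬ Moves s (edgeType ω t (j + 1)) := by
  cases s with
  | none =>
    simp only [Moves, edgeType_eq_none_iff] at h ⊢
    rw [Int.not_odd_iff_even]; exact h.add_one
  | some i =>
    simp only [Moves, ne_eq, edgeType_eq_none_iff] at h ⊢
    rw [Int.not_odd_iff_even] at h
    exact fun h' => h'.1 h.1.add_one

/-! ### The Gray code of an integer -/

/-- The first `n` digits of the (complemented) Gray code of an integer. -/
def grayCode : ℕ → ℤ → List Bool
  | 0, _ => []
  | n + 1, j => decide (j % 2 = (j / 2) % 2) :: grayCode n (j / 2)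

theorem exists_grayCode_eq (v : List Bool) : ∃ j : ℤ, grayCode v.length j = v := by
  induction v with
  | nil => exact ⟨0, rfl⟩
  | cons x v ih =>
    obtain ⟨j, hj⟩ := ih
    rcases Int.emod_two_eq_zero_or_one j with h | h <;> cases x
    · exact ⟨2 * j + 1, by
        simp [grayCode, show (2 * j + 1) / 2 = j by omega, show (2 * j + 1) % 2 = 1 by omega, h, hj]⟩
    · exact ⟨2 * j, by simp [grayCode, h, hj]⟩
    · exact ⟨2 * j, by simp [grayCode, h, hj]⟩
    · exact ⟨2 * j + 1, by
        simp [grayCode, show (2 * j + 1) / 2 = j by omega, show (2 * j + 1) % 2 = 1 by omega, h, hj]⟩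

/-- Descent by halving: equal codes have equal tails, and the first digit then recovers the parity.
The sign condition is essential, since `0` and `-1` have the same code. -/
theorem grayCode_injective_of_nonneg (N : ℕ) (j j' : ℤ) (hN : j + j' ≤ N) (hj : 0 ≤ j)
    (hj' : 0 ≤ j') (h : ∀ n, grayCode n j = grayCode n j') : j = j' := by
  induction N using Nat.strong_induction_on generalizing j j' with
  | _ N ih =>
    by_cases h0 : j + j' = 0
    · omega
    have e : j / 2 = j' / 2 := by
      refine ih (j / 2 + j' / 2).toNat (by omega) _ _ (by omega) (by omega) (by omega) fun n => ?_
      have := h (n + 1)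
      simp only [grayCode, List.cons.injEq] at this
      exact this.2
    have := h 1
    simp only [grayCode, List.cons.injEq, and_true, decide_eq_decide, e] at this
    omega

/-- The map of vertices given by the generator with index `s`. -/
def genVertex (ω : ℕ → Fin 3) : Option (Fin 3) → List Bool → List Bool
  | none => Grigorchuk.aFun
  | some i => Grigorchuk.genFun i ω

theorem grayCode_two_mul (n : ℕ) (h : ℤ) :
    grayCode (n + 1) (2 * h) = decide (Even h) :: grayCode n h := by
  simp [grayCode, Int.even_iff, eq_comm]

theorem grayCode_two_mul_sub_one (n : ℕ) (h : ℤ) :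
    grayCode (n + 1) (2 * h - 1) = decide (Even h) :: grayCode n (h - 1) := by
  simp only [grayCode, show (2 * h - 1) / 2 = h - 1 by omega, show (2 * h - 1) % 2 = 1 by omega]
  congr 1
  simp only [decide_eq_decide, Int.even_iff]
  omega

theorem aFun_grayCode (n : ℕ) {j : ℤ} (hj : Odd j) :
    Grigorchuk.aFun (grayCode n (j - 1)) = grayCode n j := by
  obtain ⟨h, rfl⟩ := hj
  cases n with
  | zero => rfl
  | succ n =>
    simp only [grayCode, Grigorchuk.aFun, show (2 * h + 1 - 1) / 2 = h by omega,
      show (2 * h + 1 - 1) % 2 = 0 by omega, show (2 * h + 1) / 2 = h by omega,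
      show (2 * h + 1) % 2 = 1 by omega]
    congr 1
    rw [← decide_not, decide_eq_decide]
    omega

/-- Halving an even edge `2h` strips a digit common to both endpoints. It is `1` for even `h`,
matching the recursion of the generator with shifted `ω`, and `0` for odd `h`, when the next digit
is flipped. Edge `0` recurses to itself, so its label `t` is unconstrained. -/
theorem genFun_grayCode_of_moves (i : Fin 3) (ω : ℕ → Fin 3) (t : Fin 3) (n : ℕ) (j : ℤ)
    (hj : Moves (some i) (edgeType ω t j)) :
    Grigorchuk.genFun i ω (grayCode n (j - 1)) = grayCode n j := by
  induction n generalizing ω j with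
  | zero => rfl
  | succ n ih =>
    have he : Even j := by
      rw [← Int.not_odd_iff_even, ← edgeType_eq_none_iff ω t]; exact hj.1
    obtain ⟨h, rfl⟩ := even_iff_two_dvd.1 he
    rw [grayCode_two_mul, grayCode_two_mul_sub_one]
    by_cases hh : Even h
    · rw [edgeType_two_mul_even ω t hh] at hj
      simp [hh, Grigorchuk.genFun, ih _ _ hj]
    · have hh' := Int.not_even_iff_odd.1 hh
      rw [edgeType_two_mul_odd ω t hh'] at hj
      have hne : i ≠ ω 0 := fun h => hj.2 (by rw [h])
      rw [← aFun_grayCode n hh']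
      cases hc : grayCode n (h - 1) <;> simp [hh, Grigorchuk.genFun, Grigorchuk.aFun, hne]

theorem genFun_grayCode_of_not_moves (i : Fin 3) (ω : ℕ → Fin 3) (t : Fin 3) (n : ℕ) (j : ℤ)
    (hj : ¬ Moves (some i) (edgeType ω t j)) (hj' : ¬ Moves (some i) (edgeType ω t (j + 1))) :
    Grigorchuk.genFun i ω (grayCode n j) = grayCode n j := by
  induction n generalizing ω j with
  | zero => rfl
  | succ n ih =>
    -- Of the two edges at `j`, only the even one, `2 * h`, matters here; `h'` is `j / 2`, an
    -- endpoint of the edge `h`.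
    obtain ⟨h, h', hg, hm, hadj⟩ : ∃ h h' : ℤ, grayCode (n + 1) j = decide (Even h) :: grayCode n h' ∧
        ¬ Moves (some i) (edgeType ω t (2 * h)) ∧ (h' = h ∨ h' = h - 1) := by
      rcases Int.even_or_odd' j with ⟨h, rfl | rfl⟩
      · exact ⟨h, h, grayCode_two_mul n h, hj, Or.inl rfl⟩
      · refine ⟨h + 1, h, ?_, by convert hj' using 3; ring, Or.inr (by ring)⟩
        have := grayCode_two_mul_sub_one n (h + 1)
        rwa [show 2 * (h + 1) - 1 = 2 * h + 1 by ring, add_sub_cancel_right] at this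
    rw [hg]
    by_cases hh : Even h
    · rw [edgeType_two_mul_even ω t hh] at hm
      have odd_fixed : ∀ {k : ℤ}, Odd k →
          ¬ Moves (some i) (edgeType (fun n => ω (n + 1)) t k) := fun hk hm' =>
        hm'.1 (edgeType_odd _ t hk)
      have : Grigorchuk.genFun i (fun n => ω (n + 1)) (grayCode n h') = grayCode n h' := by
        rcases hadj with rfl | rfl
        · exact ih _ _ hm (odd_fixed hh.add_one)
        · exact ih _ _ (odd_fixed (hh.sub_odd odd_one)) (by simpa using hm)
      simp [hh, Grigorchuk.genFun, this]
    · rw [edgeType_two_mul_odd ω t (Int.not_even_iff_odd.1 hh)] at hm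
      have hi : i = ω 0 := by
        by_contra hne
        exact hm ⟨by simp, fun h => hne (Option.some.inj h).symm⟩
      cases hc : grayCode n h' <;> simp [hh, Grigorchuk.genFun, hi]

theorem genVertex_involutive (ω : ℕ → Fin 3) (s : Option (Fin 3)) : Involutive (genVertex ω s) := by
  cases s
  · exact Grigorchuk.aFun_involutive
  · exact Grigorchuk.genFun_involutive _ ω

theorem genVertex_grayCode_of_moves (ω : ℕ → Fin 3) (t : Fin 3) (s : Option (Fin 3)) (n : ℕ) (j : ℤ)
    (hj : Moves s (edgeType ω t j)) :
    genVertex ω s (grayCode n (j - 1)) = grayCode n j := by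
  cases s with
  | none => exact aFun_grayCode n ((edgeType_eq_none_iff ω t j).1 hj)
  | some i => exact genFun_grayCode_of_moves i ω t n j hj

theorem genVertex_grayCode_of_not_moves (ω : ℕ → Fin 3) (t : Fin 3) (s : Option (Fin 3)) (n : ℕ)
    (j : ℤ) (hj : ¬ Moves s (edgeType ω t j)) (hj' : ¬ Moves s (edgeType ω t (j + 1))) :
    genVertex ω s (grayCode n j) = grayCode n j := by
  cases s with
  | none =>
    simp only [Moves, edgeType_eq_none_iff] at hj hj'
    rw [Int.not_odd_iff_even] at hj
    exact absurd hj.add_one hj'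
  | some i => exact genFun_grayCode_of_not_moves i ω t n j hj hj'

/-! ### The sequence with two copies of the labelled line, and its orbit closure -/

/-- The alphabet: the parity of the position, the label of the edge, and the parity of its
2-adic valuation. -/
abbrev Letter := Bool × Option (Fin 3) × Bool

instance : TopologicalSpace (Option (Fin 3)) := ⊥
instance : DiscreteTopology (Option (Fin 3)) := ⟨rfl⟩

/-- The sequence in which the positions `2j` and `2j + 1` carry the label of the edge `j`. -/
noncomputable def sequence (ω : ℕ → Fin 3) (t : Fin 3) (q : Bool) (m : ℤ) : Letter :=
  (decide (Odd m), edgeType ω t (m / 2), edgeParity q (m / 2))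

/-- The pair `(t, q)` is a value of `(ω k, parity of k + 1)` for arbitrarily large `k`. -/
def IsRecurrentLabel (ω : ℕ → Fin 3) (t : Fin 3) (q : Bool) : Prop :=
  ∀ R : ℕ, ∃ k ≥ R, ω k = t ∧ decide (Odd (k + 1)) = q

theorem exists_isRecurrentLabel (ω : ℕ → Fin 3) : ∃ t q, IsRecurrentLabel ω t q := by
  obtain ⟨⟨t, q⟩, h⟩ := Finite.exists_infinite_fiber
    (fun k : ℕ => (ω k, decide (Odd (k + 1))))
  refine ⟨t, q, fun R => ?_⟩
  obtain ⟨k, hk, hR⟩ := (Set.infinite_coe_iff.1 h).exists_gt R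
  simp only [mem_preimage, mem_singleton_iff, Prod.mk.injEq] at hk
  exact ⟨k, hR.le, hk⟩

/-- The centre has valuation exactly `k + 1`, so it carries the label and parity prescribed at `0`.
A nonzero offset below `2 ^ (k + 1)` in absolute value has smaller valuation, which adding the
centre does not change. -/
theorem edge_recurrence {ω : ℕ → Fin 3} {t : Fin 3} {q : Bool} {k : ℕ} (hk : ω k = t)
    (hq : decide (Odd (k + 1)) = q) (c i : ℤ) (hi : |i| ≤ k) :
    edgeType ω t (2 ^ (k + 1) * (2 * c + 1) + i) = edgeType ω t i ∧
      edgeParity q (2 ^ (k + 1) * (2 * c + 1) + i) = edgeParity q i := by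
  have hlt : |i| < 2 ^ (k + 1) := by
    have h1 : k + 1 < 2 ^ (k + 1) := Nat.lt_two_pow_self
    have h2 : ((k + 1 : ℕ) : ℤ) < 2 ^ (k + 1) := by exact_mod_cast h1
    push_cast at h2
    omega
  have hne : (2 : ℤ) ^ (k + 1) * (2 * c + 1) + i ≠ 0 := by
    intro h0
    by_cases hi0 : i = 0
    · subst hi0
      have : 2 * c + 1 = 0 := by simpa using h0
      omega
    · refine hi0 (Int.eq_zero_of_abs_lt_dvd (m := 2 ^ (k + 1)) ⟨-(2 * c + 1), by linarith⟩ hlt)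
  by_cases hi0 : i = 0
  · subst hi0
    have hv : padicValInt 2 (2 ^ (k + 1) * (2 * c + 1) + 0) = k + 1 := by
      refine padicValInt_two_eq ⟨2 * c + 1, by ring⟩ ?_
      rw [add_zero, pow_succ, mul_dvd_mul_iff_left (by positivity)]
      omega
    rw [edgeType, edgeType, edgeParity, edgeParity, if_neg hne, if_neg hne, hv, if_pos rfl,
      if_pos rfl]
    exact ⟨congrArg some hk, hq⟩
  · have hv : padicValInt 2 (2 ^ (k + 1) * (2 * c + 1) + i) = padicValInt 2 i := by
      have hle : padicValInt 2 i < k + 1 := by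
        by_contra hcon
        exact hi0 (Int.eq_zero_of_abs_lt_dvd
          ((padicValInt_dvd_iff (p := 2) (k + 1) i).2 (Or.inr (by omega))) (by exact_mod_cast hlt))
      refine padicValInt_two_eq (dvd_add (Dvd.dvd.mul_right (pow_dvd_pow 2 hle.le) _)
        (by exact_mod_cast padicValInt_dvd (p := 2) i)) fun hd => ?_
      have hd' := (Int.dvd_add_right (Dvd.dvd.mul_right (pow_dvd_pow 2 hle) _)).1 hd
      have := (padicValInt_dvd_iff (p := 2) (padicValInt 2 i + 1) i).1 (by exact_mod_cast hd')
      omega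
    simp [edgeType, edgeParity, hne, hi0, hv]

/-- Every window of the sequence occurs with bounded gaps. -/
theorem sequence_recurrence {ω : ℕ → Fin 3} {t : Fin 3} {q : Bool} (h : IsRecurrentLabel ω t q)
    (R : ℕ) : ∃ p : ℕ, ∀ m₀ : ℤ, ∃ m : ℤ, m₀ ≤ m ∧ m ≤ m₀ + p ∧
      ∀ i : ℤ, |i| ≤ R → sequence ω t q (m + i) = sequence ω t q i := by
  obtain ⟨k, hkR, hk, hq⟩ := h R
  have hp : (0 : ℤ) < 2 ^ (k + 1) := by positivity
  -- Doubling the good centres `2 ^ (k + 1) * (2 * c + 1)` gives an arithmetic progression of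
  -- positions with this difference.
  refine ⟨4 * 2 ^ (k + 1), fun m₀ => ?_⟩
  push_cast
  generalize hP : (2 : ℤ) ^ (k + 1) = P at hp ⊢
  set c := m₀ / (4 * P) with hc
  have h1 := Int.emod_add_mul_ediv m₀ (4 * P)
  have h2 := Int.emod_nonneg m₀ (show 4 * P ≠ 0 by omega)
  have h3 := Int.emod_lt_of_pos m₀ (show 0 < 4 * P by omega)
  rw [← hc] at h1
  have key : ∀ c' : ℤ, ∀ i : ℤ, |i| ≤ R →
      sequence ω t q (2 * (P * (2 * c' + 1)) + i) = sequence ω t q i := by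
    intro c' i hi
    have hdiv : (2 * (P * (2 * c' + 1)) + i) / 2 = P * (2 * c' + 1) + i / 2 := by omega
    have hi' : |i / 2| ≤ k := by
      rw [abs_le] at hi ⊢
      omega
    have := edge_recurrence hk hq c' (i / 2) hi'
    rw [hP] at this
    simp only [sequence, hdiv, this.1, this.2, Int.odd_iff]
    congr 2
    simp
  have e : ∀ c' : ℤ, 2 * (P * (2 * c' + 1)) = 4 * P * c' + 2 * P := fun c' => by ring
  by_cases hm : m₀ ≤ 2 * (P * (2 * c + 1))
  · exact ⟨_, hm, by rw [e]; linarith, key c⟩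
  · refine ⟨_, ?_, ?_, key (c + 1)⟩ <;> rw [e] at * <;> linarith

/-- For `p = 2 ^ k * r` with `r` odd, the period would join `2 ^ k * (2 - r)` to `2 ^ (k + 1)`,
whose valuations `k` and `k + 1` differ in parity. Edge labels alone would not suffice: they are
periodic for constant `ω` with `t` equal to its value. -/
theorem edgeParity_aperiodic (q : Bool) (p : ℤ) (h : ∀ j, edgeParity q (j + p) = edgeParity q j) :
    p = 0 := by
  by_contra hp
  obtain ⟨r, hr, hr'⟩ : ∃ r, p = 2 ^ (padicValInt 2 p) * r ∧ Odd r := by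
    obtain ⟨r, hr⟩ : (2 : ℤ) ^ padicValInt 2 p ∣ p := by exact_mod_cast padicValInt_dvd (p := 2) p
    refine ⟨r, hr, ?_⟩
    by_contra hodd
    obtain ⟨u, rfl⟩ := even_iff_two_dvd.1 (Int.not_odd_iff_even.1 hodd)
    have := (padicValInt_dvd_iff (p := 2) (padicValInt 2 p + 1) p).1
      ⟨u, by push_cast; rw [pow_succ, mul_assoc]; exact hr⟩
    omega
  generalize padicValInt 2 p = k at hr
  have h1 : padicValInt 2 (2 ^ k * (2 - r)) = k := by
    refine padicValInt_two_eq ⟨_, rfl⟩ ?_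
    rw [pow_succ, mul_dvd_mul_iff_left (by positivity)]
    obtain ⟨u, rfl⟩ := hr'
    omega
  have h2 : padicValInt 2 (2 ^ k * (2 - r) + p) = k + 1 := by
    rw [hr, ← mul_add, sub_add_cancel, ← pow_succ]
    refine padicValInt_two_eq dvd_rfl ?_
    rw [pow_succ _ (k + 1)]
    intro hd
    have := Int.le_of_dvd (by positivity) hd
    have : (0 : ℤ) < 2 ^ (k + 1) := by positivity
    linarith
  have n1 : (2 : ℤ) ^ k * (2 - r) ≠ 0 := by
    refine mul_ne_zero (by positivity) ?_
    obtain ⟨u, rfl⟩ := hr'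
    omega
  have n2 : (2 : ℤ) ^ k * (2 - r) + p ≠ 0 := by
    rw [hr, ← mul_add, sub_add_cancel]; positivity
  have := h (2 ^ k * (2 - r))
  simp only [edgeParity, n1, n2, if_false, h1, h2, decide_eq_decide, Nat.odd_add_one] at this
  tauto

theorem sequence_aperiodic (ω : ℕ → Fin 3) (t : Fin 3) (q : Bool) {m m' : ℤ}
    (h : ∀ i, sequence ω t q (m + i) = sequence ω t q (m' + i)) : m = m' := by
  have h0 := h 0
  simp only [sequence, Prod.mk.injEq, decide_eq_decide, add_zero, Int.odd_iff] at h0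
  have hp : m / 2 - m' / 2 = 0 := by
    refine edgeParity_aperiodic q _ fun j => ?_
    have := h (2 * (j - m' / 2))
    simp only [sequence, Prod.mk.injEq] at this
    have h1 : (m + 2 * (j - m' / 2)) / 2 = j + (m / 2 - m' / 2) := by omega
    have h2 : (m' + 2 * (j - m' / 2)) / 2 = j := by omega
    rw [h1, h2] at this
    exact this.2.2
  omega

/-- The orbit closure of a two-sided sequence. -/
def orbitClosure {A : Type*} [TopologicalSpace A] (x : ℤ → A) : Subshift A ℤ where
  carrier := closure (range fun m : ℤ => shift m x)
  isClosed := isClosed_closure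
  mapsTo g := by
    refine MapsTo.closure ?_ (continuous_shift g)
    rintro _ ⟨m, rfl⟩
    exact ⟨m + g, shift_add m g x⟩

/-! ### Orbit closures of two-sided sequences -/

section Orbit

variable {A : Type*} [TopologicalSpace A] (x : ℤ → A)

/-- The points of the orbit, as elements of the orbit closure. -/
def orbitPoint (m : ℤ) : (orbitClosure x).carrier :=
  ⟨shift m x, subset_closure ⟨m, rfl⟩⟩

theorem denseRange_orbitPoint : DenseRange (orbitPoint x) := by
  intro y
  rw [closure_subtype]
  have : Subtype.val '' range (orbitPoint x) = range fun m : ℤ => shift m x := by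
    rw [← range_comp]; rfl
  rw [this]
  exact y.2

theorem subshiftHomeomorph_zpow_apply (Y : Subshift A ℤ) (n : ℤ) (y : Y.carrier) :
    ((subshiftHomeomorph Y ^ n) y).1 = shift n y.1 := by
  have hnat : ∀ (k : ℕ) (y : Y.carrier), ((subshiftHomeomorph Y ^ k) y).1 = shift (k : ℤ) y.1 := by
    intro k
    induction k with
    | zero => intro y; simp
    | succ k ih =>
      intro y
      rw [pow_succ]
      change ((subshiftHomeomorph Y ^ k) (subshiftHomeomorph Y y)).1 = _
      rw [ih, Nat.cast_succ, add_comm, shift_add]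
      rfl
  obtain ⟨k, rfl | rfl⟩ := n.eq_nat_or_neg
  · rw [zpow_natCast, hnat]
  · have h := hnat k ((subshiftHomeomorph Y ^ (-(k : ℤ))) y)
    rw [← zpow_natCast] at h
    have h' : (subshiftHomeomorph Y ^ (k : ℤ)) ((subshiftHomeomorph Y ^ (-(k : ℤ))) y) = y := by
      change (subshiftHomeomorph Y ^ (k : ℤ) * subshiftHomeomorph Y ^ (-(k : ℤ))) y = y
      rw [← zpow_add]; simp
    rw [h'] at h
    rw [h, ← shift_add]; simp

theorem zpow_orbitPoint (n m : ℤ) :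
    (subshiftHomeomorph (orbitClosure x) ^ n) (orbitPoint x m) = orbitPoint x (m + n) := by
  apply Subtype.ext
  rw [subshiftHomeomorph_zpow_apply]
  exact (shift_add m n x).symm

end Orbit

/-! ### Density of half-orbits and minimality from uniform recurrence -/

section Recurrent

variable {A : Type*} [TopologicalSpace A] [DiscreteTopology A] {x : ℤ → A}

theorem mem_closure_iff_windows (S : Set (ℤ → A)) (z : ℤ → A) :
    z ∈ closure S ↔ ∀ R : ℕ, ∃ y ∈ S, ∀ i : ℤ, |i| ≤ R → y i = z i := by
  constructor
  · intro h R
    obtain ⟨y, hy, hyS⟩ := mem_closure_iff.1 h _ (isOpen_cylinder (Finset.Icc (-R : ℤ) R) z)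
      (fun _ _ => rfl)
    exact ⟨y, hyS, fun i hi => hy i (Finset.mem_Icc.2 (abs_le.1 hi))⟩
  · intro h
    rw [mem_closure_iff]
    intro U hU hz
    obtain ⟨I, u, hu, hIU⟩ := isOpen_pi_iff.1 hU z hz
    obtain ⟨y, hyS, hy⟩ := h (I.sup Int.natAbs)
    refine ⟨y, hIU fun i hi => ?_, hyS⟩
    have hle : i.natAbs ≤ I.sup Int.natAbs := Finset.le_sup (f := Int.natAbs) hi
    rw [hy i (by rw [Int.abs_eq_natAbs]; exact_mod_cast hle)]
    exact (hu i hi).2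

/-- Every right half of a recurrent orbit is dense in the orbit closure. -/
theorem dense_orbitPoint_ge
    (hx : ∀ R : ℕ, ∃ p : ℕ, ∀ m₀ : ℤ, ∃ m : ℤ, m₀ ≤ m ∧ m ≤ m₀ + p ∧
      ∀ i : ℤ, |i| ≤ R → x (m + i) = x i) (B : ℤ) :
    Dense (orbitPoint x '' Ici B) := by
  suffices h : range (orbitPoint x) ⊆ closure (orbitPoint x '' Ici B) from
    dense_closure.1 ((denseRange_orbitPoint x).mono h)
  rintro _ ⟨n, rfl⟩
  rw [closure_subtype, mem_closure_iff_windows]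
  intro R
  obtain ⟨p, hp⟩ := hx (R + n.natAbs)
  obtain ⟨m, hm, -, hm'⟩ := hp (B - n)
  refine ⟨_, ⟨_, ⟨m + n, by simp only [mem_Ici]; omega, rfl⟩, rfl⟩, fun i hi => ?_⟩
  change x (m + n + i) = x (n + i)
  rw [add_assoc, hm' (n + i)]
  push_cast
  exact (abs_add_le n i).trans (by rw [Int.abs_eq_natAbs n]; omega)

theorem isMinimalHomeomorph_of_recurrence
    (hx : ∀ R : ℕ, ∃ p : ℕ, ∀ m₀ : ℤ, ∃ m : ℤ, m₀ ≤ m ∧ m ≤ m₀ + p ∧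
      ∀ i : ℤ, |i| ≤ R → x (m + i) = x i) :
    IsMinimalHomeomorph (subshiftHomeomorph (orbitClosure x)) := by
  intro y
  suffices h : range (orbitPoint x) ⊆
      closure (range fun n : ℤ => (subshiftHomeomorph (orbitClosure x) ^ n) y) from
    dense_closure.1 ((denseRange_orbitPoint x).mono h)
  rintro _ ⟨n, rfl⟩
  rw [closure_subtype, mem_closure_iff_windows]
  intro R
  obtain ⟨p, hp⟩ := hx (R + n.natAbs)
  -- The extra radius `p` guarantees that the part of `y` agreeing with the orbit contains a full
  -- copy of the central window.
  obtain ⟨_, ⟨m₀, rfl⟩, hm₀⟩ := (mem_closure_iff_windows _ y.1).1 y.2 (R + n.natAbs + p)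
  obtain ⟨m, hm, hm', hw⟩ := hp m₀
  refine ⟨_, ⟨_, ⟨m - m₀ + n, rfl⟩, rfl⟩, fun i hi => ?_⟩
  have hni : |n + i| ≤ (R + n.natAbs : ℕ) := by
    push_cast
    exact (abs_add_le n i).trans (by rw [Int.abs_eq_natAbs n]; omega)
  rw [subshiftHomeomorph_zpow_apply]
  change y.1 (m - m₀ + n + i) = x (n + i)
  rw [← hw (n + i) hni, ← hm₀ (m - m₀ + n + i)]
  · change x (m₀ + (m - m₀ + n + i)) = _
    congr 1; ring
  · rw [abs_le] at hni ⊢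
    push_cast at hni ⊢
    omega

end Recurrent

/-! ### Elements of the topological full group given by local rules -/

section LocalRule

variable {A : Type*} [TopologicalSpace A] [DiscreteTopology A]

/-- The map of positions of `x` that moves `m` by a number read off from the letters at `m` and
`m + 2`. -/
def localMove (x : ℤ → A) (f : A → A → ℤ) (m : ℤ) : ℤ := m + f (x m) (x (m + 2))

/-- The rule reads finitely many letters, so it defines a continuous map with locally constant
displacement on the whole orbit closure. Being an involution on the dense orbit, this map is its own
inverse everywhere. -/
theorem exists_topologicalFullGroup_localMove (x : ℤ → A) (f : A → A → ℤ)
    (hf : Involutive (localMove x f)) :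
    ∃ g : topologicalFullGroup (subshiftHomeomorph (orbitClosure x)),
      ∀ m, g.1 (orbitPoint x m) = orbitPoint x (localMove x f m) := by
  set φ := subshiftHomeomorph (orbitClosure x)
  let n : (orbitClosure x).carrier → ℤ := fun y => f (y.1 0) (y.1 2)
  have hn : Continuous n := by
    have h : Continuous fun p : A × A => f p.1 p.2 := continuous_of_discreteTopology
    have hc : ∀ i : ℤ, Continuous fun y : (orbitClosure x).carrier => y.1 i := fun i =>
      (continuous_apply i).comp continuous_subtype_val
    exact h.comp ((hc 0).prodMk (hc 2))
  let F : (orbitClosure x).carrier → (orbitClosure x).carrier := fun y => (φ ^ n y) y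
  have hF : Continuous F := by
    refine continuous_iff_continuousAt.2 fun y => ?_
    have h : ∀ᶠ z in nhds y, n z = n y :=
      (hn.tendsto y).eventually (p := fun k => k = n y) (by simp)
    refine ((φ ^ n y).continuous.continuousAt (x := y)).congr ?_
    filter_upwards [h] with z hz
    simp only [F, hz]
  have hFo : ∀ m, F (orbitPoint x m) = orbitPoint x (localMove x f m) := by
    intro m
    have : n (orbitPoint x m) = f (x m) (x (m + 2)) := by simp [n, orbitPoint]
    simp only [F, this, localMove]
    exact zpow_orbitPoint x _ m
  have hFF : Involutive F := by
    refine fun y => congrFun ((denseRange_orbitPoint x).equalizer (hF.comp hF) continuous_id ?_) y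
    funext m
    simp [hFo, hf m]
  exact ⟨⟨⟨hFF.toPerm, hF, hF⟩, n, hn, fun _ => rfl⟩, hFo⟩

/-- A homeomorphism is determined by its values on the orbit. -/
theorem homeomorph_ext_orbitPoint {x : ℤ → A}
    {g h : topologicalFullGroup (subshiftHomeomorph (orbitClosure x))}
    (H : ∀ m, g.1 (orbitPoint x m) = h.1 (orbitPoint x m)) : g = h :=
  Subtype.ext (Homeomorph.ext fun y => congrFun
    ((denseRange_orbitPoint x).equalizer g.1.continuous h.1.continuous (funext H)) y)

end LocalRule

/-! ### The local rules of the generators -/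

/-- The local rule of the generator with index `s`, applied at the positions whose parity
satisfies `E`. -/
def genRule (E : Bool → Bool) (s : Option (Fin 3)) (u v : Letter) : ℤ :=
  if E u.1 then (if Moves s v.2.1 then 2 else if Moves s u.2.1 then -2 else 0) else 0

/-- The local rule that exchanges the two copies of the line. -/
def swapRule (u _ : Letter) : ℤ := if u.1 then -1 else 1

/-- The involution of the line `ℤ` given by the generator with index `s`. -/
noncomputable def lineMove (ω : ℕ → Fin 3) (t : Fin 3) (s : Option (Fin 3)) (j : ℤ) : ℤ :=
  if Moves s (edgeType ω t (j + 1)) then j + 1 else if Moves s (edgeType ω t j) then j - 1 else j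

variable (ω : ℕ → Fin 3) (t : Fin 3) (q : Bool)

theorem lineMove_involutive (s : Option (Fin 3)) : Involutive (lineMove ω t s) := by
  intro j
  have h1 := not_moves_adjacent ω t s (j + 1)
  have h2 := not_moves_adjacent ω t s j
  have h3 := not_moves_adjacent ω t s (j - 1)
  rw [sub_add_cancel] at h3
  by_cases ha : Moves s (edgeType ω t (j + 1))
  · simp [lineMove, ha, h1 ha]
  · by_cases hb : Moves s (edgeType ω t j) <;> simp [lineMove, ha, hb]

theorem grayCode_lineMove (s : Option (Fin 3)) (n : ℕ) (j : ℤ) :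
    grayCode n (lineMove ω t s j) = genVertex ω s (grayCode n j) := by
  by_cases ha : Moves s (edgeType ω t (j + 1))
  · have := genVertex_grayCode_of_moves ω t s n (j + 1) ha
    rw [add_sub_cancel_right] at this
    simp [lineMove, ha, this]
  · by_cases hb : Moves s (edgeType ω t j)
    · have := genVertex_grayCode_of_moves ω t s n j hb
      rw [← this, genVertex_involutive]
      simp [lineMove, ha, hb]
    · rw [genVertex_grayCode_of_not_moves ω t s n j hb ha]
      simp [lineMove, ha, hb]

theorem localMove_genRule_even (E : Bool → Bool) (s : Option (Fin 3)) (j : ℤ) :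
    localMove (sequence ω t q) (genRule E s) (2 * j) =
      if E false then 2 * lineMove ω t s j else 2 * j := by
  have h1 : (2 * j + 2) / 2 = j + 1 := by omega
  simp only [localMove, genRule, sequence, lineMove, h1]
  simp only [decide_false, mul_div_cancel_left₀, ne_eq, OfNat.ofNat_ne_zero, not_false_eq_true, show ¬ Odd (2 * j) by simp]
  split_ifs <;> ring

theorem localMove_genRule_odd (E : Bool → Bool) (s : Option (Fin 3)) (j : ℤ) :
    localMove (sequence ω t q) (genRule E s) (2 * j + 1) =
      if E true then 2 * lineMove ω t s j + 1 else 2 * j + 1 := by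
  have h1 : (2 * j + 1 + 2) / 2 = j + 1 := by omega
  have h2 : (2 * j + 1) / 2 = j := by omega
  simp only [localMove, genRule, sequence, lineMove, h1, h2,
    show Odd (2 * j + 1) from ⟨j, rfl⟩, decide_true]
  split_ifs <;> ring

theorem localMove_swapRule_even (j : ℤ) :
    localMove (sequence ω t q) swapRule (2 * j) = 2 * j + 1 := by
  simp [localMove, swapRule, sequence]

theorem localMove_swapRule_odd (j : ℤ) :
    localMove (sequence ω t q) swapRule (2 * j + 1) = 2 * j := by
  simp [localMove, swapRule, sequence]

theorem localMove_genRule_involutive (E : Bool → Bool) (s : Option (Fin 3)) :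
    Involutive (localMove (sequence ω t q) (genRule E s)) := by
  intro m
  obtain ⟨j, rfl | rfl⟩ := m.even_or_odd'
  · cases h : E false <;> simp [localMove_genRule_even, h, lineMove_involutive ω t s j]
  · cases h : E true <;> simp [localMove_genRule_odd, h, lineMove_involutive ω t s j]

theorem localMove_swapRule_involutive : Involutive (localMove (sequence ω t q) swapRule) := by
  intro m
  obtain ⟨j, rfl | rfl⟩ := m.even_or_odd' <;>
    simp [localMove_swapRule_even, localMove_swapRule_odd]

/-- The permutation of the positions given by the generator with index `s`, acting on both copies
of the line. -/
noncomputable def genPerm (s : Option (Fin 3)) : Equiv.Perm ℤ :=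
  (localMove_genRule_involutive ω t q (fun _ => true) s).toPerm

theorem genPerm_even (s : Option (Fin 3)) (j : ℤ) :
    genPerm ω t q s (2 * j) = 2 * lineMove ω t s j := by
  simp [genPerm, localMove_genRule_even]

theorem genPerm_odd (s : Option (Fin 3)) (j : ℤ) :
    genPerm ω t q s (2 * j + 1) = 2 * lineMove ω t s j + 1 := by
  simp [genPerm, localMove_genRule_odd]

theorem abs_lineMove_sub_le (s : Option (Fin 3)) (j : ℤ) : |lineMove ω t s j - j| ≤ 1 := by
  unfold lineMove
  split_ifs <;> simp

open scoped commutatorElement in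
/-- The generators act through the commutator subgroup of the topological full group. -/
theorem exists_commutator_genPerm (s : Option (Fin 3)) :
    ∃ g : commutator (topologicalFullGroup (subshiftHomeomorph (orbitClosure (sequence ω t q)))),
      ∀ m, g.1.1 (orbitPoint (sequence ω t q) m) =
        orbitPoint (sequence ω t q) (genPerm ω t q s m) := by
  -- Here `g` moves only the even copy and `h` swaps the copies, so `h * g * h` is the same move on
  -- the odd copy. As both are involutions, their commutator `g * (h * g * h)` moves both copies.
  obtain ⟨g, hg⟩ := exists_topologicalFullGroup_localMove _ _
    (localMove_genRule_involutive ω t q (fun x => !x) s)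
  obtain ⟨h, hh⟩ := exists_topologicalFullGroup_localMove _ _
    (localMove_swapRule_involutive ω t q)
  have hg' : g⁻¹ = g := by
    rw [inv_eq_iff_mul_eq_one]
    refine homeomorph_ext_orbitPoint fun m => ?_
    change g.1 (g.1 _) = _
    rw [hg, hg, localMove_genRule_involutive]
    rfl
  have hh' : h⁻¹ = h := by
    rw [inv_eq_iff_mul_eq_one]
    refine homeomorph_ext_orbitPoint fun m => ?_
    change h.1 (h.1 _) = _
    rw [hh, hh, localMove_swapRule_involutive]
    rfl
  have hmem := Subgroup.commutator_mem_commutator (Subgroup.mem_top g) (Subgroup.mem_top h)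
  rw [commutatorElement_def, hg', hh', ← commutator_def] at hmem
  refine ⟨⟨g * h * g * h, hmem⟩, fun m => ?_⟩
  change g.1 (h.1 (g.1 (h.1 _))) = _
  rw [hh, hg, hh, hg]
  congr 1
  obtain ⟨j, rfl | rfl⟩ := m.even_or_odd' <;>
    simp [localMove_swapRule_even, localMove_swapRule_odd, localMove_genRule_even,
      localMove_genRule_odd, genPerm_even, genPerm_odd]

/-! ### The free group acting on positions and on the tree -/

/-- The action of the free group on the positions of the sequence. -/
noncomputable def wordPerm : FreeGroup (Option (Fin 3)) →* Equiv.Perm ℤ :=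
  FreeGroup.lift (genPerm ω t q)

/-- The generators of the Grigorchuk group. -/
def treeGen : Option (Fin 3) → (Grigorchuk.binaryTree ≃g Grigorchuk.binaryTree)
  | none => Grigorchuk.a
  | some i => Grigorchuk.gen i ω

theorem treeGen_apply (s : Option (Fin 3)) (v : List Bool) : treeGen ω s v = genVertex ω s v := by
  cases s <;> rfl

/-- The action of the free group on the tree. -/
def wordTree : FreeGroup (Option (Fin 3)) →* (Grigorchuk.binaryTree ≃g Grigorchuk.binaryTree) :=
  FreeGroup.lift (treeGen ω)

theorem range_wordTree : (wordTree ω).range = Grigorchuk.grigorchukGroup ω := by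
  rw [wordTree, FreeGroup.range_lift_eq_closure, Grigorchuk.grigorchukGroup]
  congr 1
  ext g
  simp only [mem_range, Option.exists, Fin.exists_fin_succ, treeGen, mem_insert_iff,
    mem_singleton_iff, Grigorchuk.b, Grigorchuk.c, Grigorchuk.d]
  simp only [eq_comm (b := g), IsEmpty.exists_iff, or_false]
  change _ ∨ g = Grigorchuk.gen 0 ω ∨ g = Grigorchuk.gen 1 ω ∨ g = Grigorchuk.gen 2 ω ↔ _
  tauto

theorem grayCode_genPerm (s : Option (Fin 3)) (n : ℕ) (m : ℤ) :
    grayCode n (genPerm ω t q s m / 2) = treeGen ω s (grayCode n (m / 2)) := by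
  rw [treeGen_apply, ← grayCode_lineMove ω t]
  congr 1
  obtain ⟨j, rfl | rfl⟩ := m.even_or_odd'
  · rw [genPerm_even]; simp
  · rw [genPerm_odd, show (2 * j + 1) / 2 = j by omega]; omega

theorem genPerm_emod_two (s : Option (Fin 3)) (m : ℤ) : genPerm ω t q s m % 2 = m % 2 := by
  obtain ⟨j, rfl | rfl⟩ := m.even_or_odd'
  · rw [genPerm_even]; omega
  · rw [genPerm_odd]; omega

theorem abs_genPerm_sub_le (s : Option (Fin 3)) (m : ℤ) : |genPerm ω t q s m - m| ≤ 2 := by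
  obtain ⟨j, rfl | rfl⟩ := m.even_or_odd'
  · have := abs_lineMove_sub_le ω t s j
    rw [genPerm_even]; rw [abs_le] at *; omega
  · have := abs_lineMove_sub_le ω t s j
    rw [genPerm_odd]; rw [abs_le] at *; omega

theorem genPerm_inv (s : Option (Fin 3)) : (genPerm ω t q s)⁻¹ = genPerm ω t q s := rfl

theorem treeGen_inv (s : Option (Fin 3)) : (treeGen ω s)⁻¹ = treeGen ω s := by
  cases s <;> rfl

/-- The Gray code intertwines the two actions, and a word preserves the parity of positions and
has bounded displacement. -/
theorem wordPerm_properties (w : FreeGroup (Option (Fin 3))) :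
    (∀ n m, grayCode n (wordPerm ω t q w m / 2) = wordTree ω w (grayCode n (m / 2))) ∧
      (∀ m, wordPerm ω t q w m % 2 = m % 2) ∧ ∃ B, ∀ m, |wordPerm ω t q w m - m| ≤ B := by
  have hof : ∀ s, (∀ n m, grayCode n (genPerm ω t q s m / 2) = treeGen ω s (grayCode n (m / 2))) ∧
      (∀ m, genPerm ω t q s m % 2 = m % 2) ∧ ∃ B, ∀ m, |genPerm ω t q s m - m| ≤ B := fun s =>
    ⟨grayCode_genPerm ω t q s, genPerm_emod_two ω t q s, 2, abs_genPerm_sub_le ω t q s⟩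
  induction w using FreeGroup.induction_on with
  | C1 => exact ⟨fun n m => by simp, fun m => by simp, 0, fun m => by simp⟩
  | of s => simpa [wordPerm, wordTree] using hof s
  | inv_of s _ => simpa [wordPerm, wordTree, genPerm_inv, treeGen_inv] using hof s
  | mul w w' h h' =>
    obtain ⟨h1, h2, B, h3⟩ := h
    obtain ⟨h1', h2', B', h3'⟩ := h'
    simp only [map_mul, Equiv.Perm.mul_apply, RelIso.mul_apply]
    refine ⟨fun n m => by rw [h1, h1'], fun m => by rw [h2, h2'], B + B', fun m => ?_⟩
    exact (abs_sub_le _ (wordPerm ω t q w' m) _).trans (add_le_add (h3 _) (h3' _))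

/-- A word that acts trivially on the line acts trivially on the tree. -/
theorem wordTree_eq_one_of_wordPerm_eq_one (w : FreeGroup (Option (Fin 3)))
    (h : wordPerm ω t q w = 1) : wordTree ω w = 1 := by
  refine RelIso.ext fun v => ?_
  obtain ⟨j, hj⟩ := exists_grayCode_eq v
  have := (wordPerm_properties ω t q w).1 v.length (2 * j)
  simpa [h, hj] using this.symm

/-- A word that acts trivially on the tree fixes all large positions. -/
theorem exists_wordPerm_eq_self (w : FreeGroup (Option (Fin 3))) (h : wordTree ω w = 1) :
    ∃ B, ∀ m ≥ B, wordPerm ω t q w m = m := by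
  obtain ⟨h1, h2, B, h3⟩ := wordPerm_properties ω t q w
  have hB : 0 ≤ B := (abs_nonneg _).trans (h3 0)
  -- From `B` on, the displacement bound keeps the image nonnegative, where codes are injective;
  -- preserved parity then selects the same copy.
  refine ⟨B, fun m hm => ?_⟩
  have hm' := abs_le.1 (h3 m)
  have hdiv : wordPerm ω t q w m / 2 = m / 2 := by
    refine grayCode_injective_of_nonneg (wordPerm ω t q w m / 2 + m / 2).toNat _ _ (by omega)
      (by omega) (by omega) fun n => ?_
    rw [h1, h]; rfl
  have := h2 m
  omega

end LabelledLine

open LabelledLine in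
theorem mainTheorem4 (ω : ℕ → Fin 3) :
    ∃ (A : Type) (_ : Finite A) (_ : TopologicalSpace A) (_ : DiscreteTopology A)
      (Y : SymbolicDynamics.FullShift.Subshift A ℤ),
      Y.carrier.Infinite ∧
      IsMinimalHomeomorph (subshiftHomeomorph Y) ∧
      ∃ f : Grigorchuk.grigorchukGroup ω →*
          commutator (topologicalFullGroup (subshiftHomeomorph Y)),
        Function.Injective f := by
  obtain ⟨t, q, htq⟩ := exists_isRecurrentLabel ω
  have hrec := sequence_recurrence htq
  have hinj : Injective (orbitPoint (sequence ω t q)) := fun m m' h =>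
    sequence_aperiodic ω t q fun i => congrFun (congrArg Subtype.val h) i
  refine ⟨Letter, inferInstance, inferInstance, inferInstance, orbitClosure (sequence ω t q),
    Set.infinite_coe_iff.1 (Infinite.of_injective _ hinj),
    isMinimalHomeomorph_of_recurrence hrec, ?_⟩
  choose g hg using exists_commutator_genPerm ω t q
  let β := FreeGroup.lift g
  have hβ : ∀ w m, (β w).1.1 (orbitPoint (sequence ω t q) m) =
      orbitPoint (sequence ω t q) (wordPerm ω t q w m) := by
    intro w
    induction w using FreeGroup.induction_on with
    | C1 => intro m; simp [β]
    | of s => intro m; simpa [β, wordPerm] using hg s m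
    | inv_of s _ =>
      intro m
      have := hg s (genPerm ω t q s m)
      simp only [β, wordPerm, map_inv, FreeGroup.lift_apply_of, genPerm_inv]
      change (g s).1.1.symm _ = _
      rw [Homeomorph.symm_apply_eq, this]
      congr 1
      exact (localMove_genRule_involutive ω t q (fun _ => true) s m).symm
    | mul w w' h h' =>
      intro m
      rw [map_mul, map_mul]
      change (β w).1.1 ((β w').1.1 _) = _
      rw [h', h]; rfl
  -- Equal kernels identify the Grigorchuk group with the image of `β`, both being quotients of one
  -- free group.
  have hker : (wordTree ω).ker = β.ker := by
    ext w
    rw [MonoidHom.mem_ker, MonoidHom.mem_ker]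
    constructor
    · intro h
      obtain ⟨B, hB⟩ := exists_wordPerm_eq_self ω t q w h
      refine Subtype.ext (Subtype.ext (Homeomorph.ext fun y => congrFun
        (Continuous.ext_on (dense_orbitPoint_ge hrec B) (β w).1.1.continuous continuous_id ?_) y))
      rintro _ ⟨m, hm, rfl⟩
      rw [hβ, hB m hm]; rfl
    · intro h
      refine wordTree_eq_one_of_wordPerm_eq_one ω t q w (Equiv.ext fun m => hinj ?_)
      rw [← hβ, h]; rfl
  let e : Grigorchuk.grigorchukGroup ω ≃* FreeGroup (Option (Fin 3)) ⧸ β.ker :=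
    (MulEquiv.subgroupCongr (range_wordTree ω).symm).trans
      ((QuotientGroup.quotientKerEquivRange (wordTree ω)).symm.trans
        (QuotientGroup.quotientMulEquivOfEq hker))
  exact ⟨(QuotientGroup.kerLift β).comp e.toMonoidHom,
    (QuotientGroup.kerLift_injective β).comp e.injective⟩
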